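/- Let $\mathbb D$ be the open unit disc, $\mathbb T$ the unit circle with normalised arc length, and $H^2\subset L^2(\mathbb T)$ the Hardy space. An inner function is a $\theta\in H^2$ with $|\theta|=1$ a.e. on $\mathbb T$; its model space is $K_\theta=H^2\ominus\theta H^2$, with orthogonal projection $P_\theta:L^2(\mathbb T)\to K_\theta$ and conjugation $C_\theta f=\theta\,\overline{zf}$. A truncated Toeplitz operator (TTO) on $K_\theta$ is a bounded operator $A$ on $K_\theta$ for which there is $\varphi\in L^2(\mathbb T)$ with $Af=P_\theta(\varphi f)$ for all $f\in K_\theta\cap L^\infty$. For $t\in\mathbb D$ let $k_t(z)=\frac{1-\overline{\theta(t)}\theta(z)}{1-\bar t z}$ be the reproducing kernel of $K_\theta$ at $t$, and $\kappa_t=k_t/\|k_t\|$. For $t\in\mathbb D$ and $\alpha\in\mathbb T$ the generalised Clark operator on $K_\theta$ is $$U_{t,\alpha}f=P_\theta\Big(\frac{z-t}{1-\bar t z}f\Big)+(\alpha+\theta(t))\,\langle f,C_\theta\kappa_t\rangle\,\kappa_t .$$ When $K_\theta$ is finite-dimensional, a modified Clark basis of $K_\theta$ is an orthonormal basis $(v_i)$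 of $K_\theta$ such that $C_\theta v_i=v_i$ for all $i$ and, for some $t\in\mathbb D$ and $\alpha\in\mathbb T$, every $v_i$ is an eigenvector of $U_{t,\alpha}$. Let $a,b,c\in\mathbb R$ and let $S$ be any one of the matrices $$\begin{pmatrix} a&0&1\\0&b&0\\1&0&c\end{pmatrix},\qquad \begin{pmatrix} a&1&0\\1&b&0\\0&0&c\end{pmatrix},\qquad \begin{pmatrix} a&0&0\\0&b&1\\0&1&c\end{pmatrix}.$$ Then $S$ is unitarily equivalent to a TTO on some model space $K_\theta$, but there are no inner function $\theta$, modified Clark basis of $K_\theta$ and TTO on $K_\theta$ such that $S$ is the matrix of that TTO with respect to that basis. Consequently the following question has a negative answer: is every complex symmetric matrix $M$ (i.e. $M\in\mathbb C^{n\times n}$ with $M=M^{T}$) that is unitarily equivalent to a TTO the matrix of some TTO, on some model space $K_\theta$, with respect to some modified Clark basis of $K_\theta$? -/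

import Mathlib

open MeasureTheory Complex
open scoped ENNReal InnerProductSpace ComplexConjugate UnitDisc

noncomputable section

namespace ModelSpace

/-- `L²(𝕋)`. The unit circle `𝕋` with normalised arc length is parametrised by `ℝ/ℤ` through
`x ↦ exp (2πix)`, so that the coordinate function `z` on `𝕋` is `fourier 1`, and `fourierCoeff f n`
is the coefficient of `zⁿ` in `f`. -/
abbrev L2 : Type := Lp ℂ 2 (AddCircle.haarAddCircle : Measure UnitAddCircle)

/-- The Hardy space `H²`, as a subspace of `L²(𝕋)`: the negative Fourier coefficients vanish. -/
def H2 : Submodule ℂ L2 where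
  carrier := {f | ∀ n : ℤ, n < 0 → fourierCoeff f n = 0}
  zero_mem' n _ := by
    rw [← fourierBasis_repr]; simp
  add_mem' {f g} hf hg n hn := by
    have h1 := hf n hn
    have h2 := hg n hn
    rw [← fourierBasis_repr] at h1 h2 ⊢
    simp [h1, h2]
  smul_mem' c f hf n hn := by
    have h1 := hf n hn
    rw [← fourierBasis_repr] at h1 ⊢
    simp [h1]

theorem isClosed_H2 : IsClosed (H2 : Set L2) := by
  have h : (H2 : Set L2) = ⋂ n : ℤ, ⋂ _ : n < 0, {f : L2 | ⟪fourierBasis n, f⟫_ℂ = 0} := by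
    ext f
    simp only [Set.mem_iInter, Set.mem_ofPred_eq, ← HilbertBasis.repr_apply_apply,
      fourierBasis_repr]
    rfl
  rw [h]
  exact isClosed_iInter fun n => isClosed_iInter fun _ =>
    isClosed_eq (continuous_const.inner continuous_id) continuous_const

/-- The value at a point `t` of the open unit disc of (the analytic extension of) `f ∈ H²`. -/
def diskEval (f : L2) (t : 𝔻) : ℂ := ∑' n : ℕ, fourierCoeff f (n : ℤ) * (t : ℂ) ^ n

/-- Multiplication by an essentially bounded function, on `L²(𝕋)`. -/
def mulOp (g : UnitAddCircle → ℂ) (hg : MemLp g ∞ AddCircle.haarAddCircle) : L2 →ₗ[ℂ] L2 where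
  toFun f := ((Lp.memLp f).mul (p := ∞) hg : MemLp (g * ⇑f) 2 AddCircle.haarAddCircle).toLp
  map_add' f₁ f₂ := by
    rw [← MemLp.toLp_add]
    apply MemLp.toLp_congr
    filter_upwards [Lp.coeFn_add f₁ f₂] with x hx
    rw [Pi.mul_apply, hx]
    simp [mul_add]
  map_smul' c f := by
    rw [RingHom.id_apply, ← MemLp.toLp_const_smul]
    apply MemLp.toLp_congr
    filter_upwards [Lp.coeFn_smul c f] with x hx
    rw [Pi.mul_apply, hx]
    simp [mul_left_comm]

theorem memLp_continuous (g : C(UnitAddCircle, ℂ)) : MemLp g ∞ AddCircle.haarAddCircle :=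
  memLp_top_of_bound g.continuous.aestronglyMeasurable ‖g‖
    (Filter.Eventually.of_forall g.norm_coe_le_norm)

/-- Multiplication by a continuous function, on `L²(𝕋)`. -/
def mulC (g : C(UnitAddCircle, ℂ)) : L2 →ₗ[ℂ] L2 := mulOp g (memLp_continuous g)

/-- Inner functions, through their boundary values: elements of `H²` that are unimodular
almost everywhere on `𝕋`. -/
structure InnerFunction where
  toL2 : L2
  mem_H2 : toL2 ∈ H2
  norm_eq_one : ∀ᵐ x ∂(AddCircle.haarAddCircle : Measure UnitAddCircle), ‖toL2 x‖ = 1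

theorem InnerFunction.memLp_top (θ : InnerFunction) :
    MemLp θ.toL2 ∞ AddCircle.haarAddCircle :=
  memLp_top_of_bound (Lp.aestronglyMeasurable _) 1 (θ.norm_eq_one.mono fun _ h => h.le)

/-- The model space `K_θ = H² ⊖ θH²`. -/
def K (θ : InnerFunction) : Submodule ℂ L2 :=
  H2 ⊓ (H2.map (mulOp θ.toL2 θ.memLp_top))ᗮ

instance (θ : InnerFunction) : CompleteSpace (K θ) :=
  (isClosed_H2.inter (Submodule.isClosed_orthogonal _)).completeSpace_coe

/-- The bounded operator `A` on `K_θ` is a truncated Toeplitz operator: for some symbol `φ ∈ L²`,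
`A f = P_θ (φ f)` for all bounded `f ∈ K_θ`, with `P_θ` the orthogonal projection of `L²(𝕋)`
onto `K_θ`. -/
def IsTTO (θ : InnerFunction) (A : K θ →L[ℂ] K θ) : Prop :=
  ∃ φ : L2, ∀ (f : K θ) (hf : MemLp (f : L2) ∞ AddCircle.haarAddCircle),
    A f = (K θ).orthogonalProjectionOnto (mulOp (f : L2) hf φ)

/-- The canonical conjugation `C_θ f = θ · conj (z f)`. -/
def conjC (θ : InnerFunction) (f : L2) : L2 :=
  mulOp θ.toL2 θ.memLp_top (star (mulC (fourier 1) f))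

theorem one_sub_ne_zero (t : 𝔻) (x : UnitAddCircle) : 1 - conj (t : ℂ) * fourier 1 x ≠ 0 := by
  intro h
  have h1 : ‖conj (t : ℂ) * fourier 1 x‖ = 1 := by rw [← sub_eq_zero.mp h]; simp
  rw [norm_mul, fourier_apply, Circle.norm_coe, mul_one, RCLike.norm_conj] at h1
  exact t.norm_lt_one.ne h1

/-- The function `1 / (1 - conj t · z)` on the circle. -/
def szego (t : 𝔻) : C(UnitAddCircle, ℂ) where
  toFun x := 1 / (1 - conj (t : ℂ) * fourier 1 x)
  continuous_toFun := by
    refine continuous_const.div ?_ (one_sub_ne_zero t)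
    fun_prop

/-- The function `(z - t) / (1 - conj t · z)` on the circle. -/
def moebius (t : 𝔻) : C(UnitAddCircle, ℂ) where
  toFun x := (fourier 1 x - (t : ℂ)) / (1 - conj (t : ℂ) * fourier 1 x)
  continuous_toFun := by
    refine Continuous.div ?_ ?_ (one_sub_ne_zero t) <;> fun_prop

/-- The reproducing kernel `k_t = (1 - conj (θ t) · θ) / (1 - conj t · z)` of `K_θ` at `t ∈ 𝔻`
(`fourierLp 2 0` is the constant function `1`). -/
def kernel (θ : InnerFunction) (t : 𝔻) : L2 :=
  mulC (szego t) (fourierLp 2 0 - conj (diskEval θ.toL2 t) • θ.toL2)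

/-- The normalised reproducing kernel `k_t / ‖k_t‖`. -/
def normKernel (θ : InnerFunction) (t : 𝔻) : L2 :=
  ((‖kernel θ t‖⁻¹ : ℝ) : ℂ) • kernel θ t

/-- The generalised Clark operator on `K_θ`,
`U_{t,α} f = P_θ ((z - t) / (1 - conj t · z) · f) + (α + θ t) ⟨f, C_θ κ_t⟩ κ_t`,
where `κ_t = k_t / ‖k_t‖` is the normalised kernel. Its values lie in `K_θ`; they are recorded as
elements of `L²(𝕋)`. -/
def clarkOp (θ : InnerFunction) (t : 𝔻) (α : Circle) : K θ →ₗ[ℂ] L2 :=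
  (K θ).subtype ∘ₗ (K θ).orthogonalProjectionOnto.toLinearMap ∘ₗ mulC (moebius t) ∘ₗ (K θ).subtype
    + ((α : ℂ) + diskEval θ.toL2 t) •
      ((innerSL ℂ (conjC θ (normKernel θ t))).toLinearMap.smulRight (normKernel θ t)) ∘ₗ
        (K θ).subtype

/-- An orthonormal basis of `K_θ` is a modified Clark basis if it is fixed by the conjugation `C_θ`
and consists of eigenvectors of one generalised Clark operator `U_{t,α}`. -/
def IsModifiedClarkBasis (θ : InnerFunction) {n : ℕ} (v : OrthonormalBasis (Fin n) ℂ (K θ)) :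
    Prop :=
  (∀ i, conjC θ (v i) = (v i : L2)) ∧
    ∃ (t : 𝔻) (α : Circle), ∀ i, ∃ μ : ℂ, clarkOp θ t α (v i) = μ • (v i : L2)

/-- The matrix `M`, as an operator on `ℂⁿ`, is unitarily equivalent to a truncated Toeplitz operator
on some model space. -/
def UnitarilyEquivToTTO {n : ℕ} (M : Matrix (Fin n) (Fin n) ℂ) : Prop :=
  ∃ (θ : InnerFunction) (A : K θ →L[ℂ] K θ), IsTTO θ A ∧
    ∃ U : EuclideanSpace ℂ (Fin n) ≃ₗᵢ[ℂ] K θ, ∀ x, U (M.toEuclideanLin x) = A (U x)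

/-- `M` is the matrix of a truncated Toeplitz operator on some model space with respect to some
modified Clark basis of that space. -/
def IsClarkMatrixOfTTO {n : ℕ} (M : Matrix (Fin n) (Fin n) ℂ) : Prop :=
  ∃ (θ : InnerFunction) (A : K θ →L[ℂ] K θ) (v : OrthonormalBasis (Fin n) ℂ (K θ)),
    IsTTO θ A ∧ IsModifiedClarkBasis θ v ∧
      LinearMap.toMatrix v.toBasis v.toBasis A.toLinearMap = M

end ModelSpace

end

noncomputable section

namespace ModelSpace

/-! The obstruction is a linear relation between off-diagonal entries. Modulo functions proportional
to `1 / (1 - conj t · z)` times one fixed function, with a common scalar `clarkFunctional θ t f`,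
the operator `U_{t,α}` is multiplication by the Möbius function. Hence an eigenvector with
eigenvalue `μ i` has the form `v i = a i · G / p i`, where `p i = z - t - μ i (1 - conj t · z)` and
`G` is independent of `i` (`exists_eigenvector_clarkOp_eq`). Three such polynomials lie in a
two-dimensional space, so they are linearly dependent; dividing the dependence by `p 0 · p 1 · p 2`
gives a relation between `v 1 · v 2`, `v 0 · v 2` and `v 0 · v 1`. Invariance under `C_θ` makes the
matrix entries `∫ conj θ · z · φ · v i · v j`, so they inherit this relation for every symbol `φ`
(`exists_offDiagonal_relation`). Its three coefficients are nonzero, whereas each matrix `S` has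
exactly one nonzero entry above the diagonal. Conversely `S` is Hermitian, hence unitarily
diagonalisable. Every diagonal matrix is unitarily equivalent, through the discrete Fourier
transform, to a circulant matrix, which is Toeplitz and so a TTO on the model space of `zⁿ`. -/

/-! ### Multiplication operators and Fourier coefficients -/

theorem coeFn_mulOp (g : UnitAddCircle → ℂ) (hg : MemLp g ∞ AddCircle.haarAddCircle) (f : L2) :
    ⇑(mulOp g hg f) =ᵐ[AddCircle.haarAddCircle] fun x => g x * f x :=
  MemLp.coeFn_toLp ((Lp.memLp f).mul (p := ∞) hg)

theorem coeFn_mulC (g : C(UnitAddCircle, ℂ)) (f : L2) :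
    ⇑(mulC g f) =ᵐ[AddCircle.haarAddCircle] fun x => g x * f x :=
  coeFn_mulOp _ _ f

theorem integrable_coeFn (f : L2) : Integrable f AddCircle.haarAddCircle :=
  (Lp.memLp f).integrable (by norm_num)

theorem fourierCoeff_eq_of_ae {f g : UnitAddCircle → ℂ}
    (h : f =ᵐ[AddCircle.haarAddCircle] g) (n : ℤ) : fourierCoeff f n = fourierCoeff g n := by
  unfold fourierCoeff
  apply integral_congr_ae
  filter_upwards [h] with x hx
  rw [hx]

theorem fourierCoeff_fourier_mul (f : UnitAddCircle → ℂ) (m n : ℤ) :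
    fourierCoeff (fun x => fourier m x * f x) n = fourierCoeff f (n - m) := by
  unfold fourierCoeff
  congr 1 with x
  rw [smul_eq_mul, smul_eq_mul, ← mul_assoc, ← fourier_add]
  congr 3
  ring

theorem norm_fourier_apply (n : ℤ) (x : UnitAddCircle) : ‖fourier n x‖ = 1 := by
  rw [fourier_apply, Circle.norm_coe]

theorem integrable_fourier_mul {f : UnitAddCircle → ℂ} (hf : Integrable f AddCircle.haarAddCircle)
    (n : ℤ) : Integrable (fun x => fourier n x * f x) AddCircle.haarAddCircle :=
  hf.bdd_mul (fourier n).continuous.aestronglyMeasurable (c := 1)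
    (Filter.Eventually.of_forall fun x => (norm_fourier_apply n x).le)

theorem integrable_continuous_mul {f : UnitAddCircle → ℂ}
    (hf : Integrable f AddCircle.haarAddCircle) (g : C(UnitAddCircle, ℂ)) :
    Integrable (fun x => g x * f x) AddCircle.haarAddCircle :=
  hf.bdd_mul g.continuous.aestronglyMeasurable (c := ‖g‖)
    (Filter.Eventually.of_forall g.norm_coe_le_norm)

theorem fourierCoeff_sub' {f g : UnitAddCircle → ℂ} (hf : Integrable f AddCircle.haarAddCircle)
    (hg : Integrable g AddCircle.haarAddCircle) (n : ℤ) :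
    fourierCoeff (fun x => f x - g x) n = fourierCoeff f n - fourierCoeff g n := by
  unfold fourierCoeff
  simp only [smul_eq_mul, mul_sub]
  exact integral_sub (integrable_fourier_mul hf _) (integrable_fourier_mul hg _)

theorem fourierCoeff_const_mul (c : ℂ) (f : UnitAddCircle → ℂ) (n : ℤ) :
    fourierCoeff (fun x => c * f x) n = c * fourierCoeff f n :=
  fourierCoeff.const_mul f c n

theorem norm_fourierCoeff_le (f : UnitAddCircle → ℂ) (n : ℤ) :
    ‖fourierCoeff f n‖ ≤ ∫ x, ‖f x‖ ∂AddCircle.haarAddCircle := by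
  unfold fourierCoeff
  refine (norm_integral_le_integral_norm _).trans (le_of_eq ?_)
  congr 1 with x
  rw [norm_smul, norm_fourier_apply, one_mul]

theorem fourierCoeff_one_sub_mul {f : UnitAddCircle → ℂ}
    (hf : Integrable f AddCircle.haarAddCircle) (c : ℂ) (n : ℤ) :
    fourierCoeff (fun x => (1 - c * fourier 1 x) * f x) n =
      fourierCoeff f n - c * fourierCoeff f (n - 1) := by
  have h : (fun x => (1 - c * fourier 1 x) * f x) =
      fun x => f x - c * (fourier 1 x * f x) := by ext x; ring
  rw [h, fourierCoeff_sub' hf ((integrable_fourier_mul hf 1).const_mul c),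
    fourierCoeff_const_mul, fourierCoeff_fourier_mul]

/-- Division by `1 - conj t · z` preserves the vanishing of the negative Fourier coefficients. -/
theorem fourierCoeff_eq_zero_of_one_sub_mul {f : UnitAddCircle → ℂ}
    (hf : Integrable f AddCircle.haarAddCircle) (t : 𝔻)
    (h : ∀ n < 0, fourierCoeff (fun x => (1 - conj (t : ℂ) * fourier 1 x) * f x) n = 0) :
    ∀ n < 0, fourierCoeff f n = 0 := by
  have hstep : ∀ n < 0, fourierCoeff f n = conj (t : ℂ) * fourierCoeff f (n - 1) := by
    intro n hn
    have := h n hn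
    rw [fourierCoeff_one_sub_mul hf] at this
    exact sub_eq_zero.mp this
  have hpow : ∀ k : ℕ, ∀ n < 0,
      fourierCoeff f n = conj (t : ℂ) ^ k * fourierCoeff f (n - k) := by
    intro k
    induction k with
    | zero => intro n _; simp
    | succ k ih =>
      intro n hn
      rw [ih n hn, hstep (n - k) (by omega), pow_succ, mul_assoc]
      push_cast
      rw [sub_sub]
  intro n hn
  -- The coefficient equals `conj t ^ k` times one bounded by the `L¹` norm, for every `k`; since
  -- `|t| < 1` it vanishes.
  have hlim : Filter.Tendsto
      (fun k : ℕ => ‖(t : ℂ)‖ ^ k * ∫ x, ‖f x‖ ∂AddCircle.haarAddCircle) Filter.atTop (nhds 0) := by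
    simpa using (tendsto_pow_atTop_nhds_zero_of_lt_one (norm_nonneg _) t.norm_lt_one).mul_const
      (∫ x, ‖f x‖ ∂AddCircle.haarAddCircle)
  refine norm_le_zero_iff.mp (ge_of_tendsto' hlim fun k => ?_)
  rw [hpow k n hn, norm_mul, norm_pow, RCLike.norm_conj]
  gcongr
  exact norm_fourierCoeff_le f _

/-! ### Fourier description of the model space -/

theorem inner_eq_zero_of_fourierCoeff {f g : L2} (hf : f ∈ H2)
    (hg : ∀ n : ℤ, 0 ≤ n → fourierCoeff g n = 0) : ⟪f, g⟫_ℂ = 0 := by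
  rw [← (fourierBasis (T := (1 : ℝ))).tsum_inner_mul_inner f g]
  refine (tsum_congr fun n => ?_).trans tsum_zero
  rcases lt_or_ge n 0 with hn | hn
  · rw [← inner_conj_symm, ← HilbertBasis.repr_apply_apply, fourierBasis_repr, hf n hn]; simp
  · rw [← HilbertBasis.repr_apply_apply _ g, fourierBasis_repr, hg n hn]; simp

theorem fourierLp_mem_H2 {n : ℤ} (hn : 0 ≤ n) : (fourierLp 2 n : L2) ∈ H2 := by
  intro m hm
  rw [← fourierBasis_repr, ← coe_fourierBasis, HilbertBasis.repr_self, lp.single_apply_ne]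
  omega

theorem InnerFunction.memLp_conj (θ : InnerFunction) :
    MemLp (fun x => conj (θ.toL2 x)) ∞ AddCircle.haarAddCircle :=
  θ.memLp_top.star

theorem inner_mulOp_left (θ : InnerFunction) (g f : L2) :
    ⟪mulOp θ.toL2 θ.memLp_top g, f⟫_ℂ = ⟪g, mulOp _ θ.memLp_conj f⟫_ℂ := by
  rw [L2.inner_def, L2.inner_def]
  apply integral_congr_ae
  filter_upwards [coeFn_mulOp _ θ.memLp_top g, coeFn_mulOp _ θ.memLp_conj f] with x h1 h2
  rw [h1, h2]
  simp only [RCLike.inner_apply, map_mul]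
  ring

theorem inner_fourierLp (n : ℤ) (f : L2) : ⟪(fourierLp 2 n : L2), f⟫_ℂ = fourierCoeff f n := by
  rw [← fourierBasis_repr, HilbertBasis.repr_apply_apply, coe_fourierBasis]

/-- The adjoint of multiplication by `θ` is multiplication by `conj θ`, so orthogonality to `θH²`
becomes orthogonality of `conj θ · f` to `H²`. Testing against monomials suffices by Parseval. -/
theorem mem_K_iff (θ : InnerFunction) (f : L2) :
    f ∈ K θ ↔ (∀ n < 0, fourierCoeff f n = 0) ∧
      ∀ n : ℤ, 0 ≤ n → fourierCoeff (fun x => conj (θ.toL2 x) * f x) n = 0 := by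
  have hc : ∀ n, fourierCoeff (fun x => conj (θ.toL2 x) * f x) n =
      fourierCoeff (mulOp _ θ.memLp_conj f) n := fun n =>
    (fourierCoeff_eq_of_ae (coeFn_mulOp _ θ.memLp_conj f) n).symm
  simp only [K, Submodule.mem_inf, hc]
  refine and_congr Iff.rfl ⟨fun h n hn => ?_, fun h => ?_⟩
  · have := (Submodule.mem_orthogonal _ _).mp h _
      (Submodule.mem_map_of_mem (fourierLp_mem_H2 hn))
    rwa [inner_mulOp_left, inner_fourierLp] at this
  · rw [Submodule.mem_orthogonal]
    rintro _ ⟨g, hg, rfl⟩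
    rw [inner_mulOp_left]
    exact inner_eq_zero_of_fourierCoeff hg h

theorem coeFn_fourierLp_two (n : ℤ) :
    ⇑(fourierLp 2 n : L2) =ᵐ[AddCircle.haarAddCircle] fourier n :=
  coeFn_fourierLp 2 n

theorem fourierCoeff_fourierLp (m n : ℤ) :
    fourierCoeff (fourierLp 2 m : L2) n = if n = m then 1 else 0 := by
  rw [← inner_fourierLp]
  exact orthonormal_iff_ite.mp (orthonormal_fourier (T := (1 : ℝ))) n m

theorem eq_zero_of_fourierCoeff {f : L2} (h : ∀ n, fourierCoeff f n = 0) : f = 0 := by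
  apply (fourierBasis (T := (1 : ℝ))).repr.injective
  ext n
  rw [fourierBasis_repr, h n]
  simp

theorem fourierCoeff_conj (f : UnitAddCircle → ℂ) (n : ℤ) :
    fourierCoeff (fun x => conj (f x)) n = conj (fourierCoeff f (-n)) := by
  unfold fourierCoeff
  rw [← integral_conj]
  congr 1 with x
  simp only [smul_eq_mul, map_mul, neg_neg]
  rw [← fourier_neg]

theorem InnerFunction.conj_mul_self (θ : InnerFunction) :
    ∀ᵐ x ∂(AddCircle.haarAddCircle : Measure UnitAddCircle),
      conj (θ.toL2 x) * θ.toL2 x = 1 := by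
  filter_upwards [θ.norm_eq_one] with x hx
  rw [Complex.conj_mul', hx]; simp

/-! ### Boundedness of finite-dimensional model spaces -/

theorem fourierCoeff_sum_smul_fourierLp (s : Finset ℕ) (c : ℕ → ℂ) (k : ℤ) :
    fourierCoeff (∑ m ∈ s, c m • (fourierLp 2 (m : ℤ) : L2) : L2) k =
      ∑ m ∈ s, c m * if k = m then 1 else 0 := by
  rw [← inner_fourierLp, inner_sum]
  refine Finset.sum_congr rfl fun m _ => ?_
  rw [inner_smul_right, inner_fourierLp, fourierCoeff_fourierLp]

/-- The analytic part of `conj θ · zⁿ`. -/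
def analyticPart (θ : InnerFunction) (n : ℕ) : L2 :=
  ∑ m ∈ Finset.range (n + 1), conj (fourierCoeff θ.toL2 ((n : ℤ) - m)) • fourierLp 2 (m : ℤ)

/-- The orthogonal projection of `zⁿ` onto `K_θ`. -/
def projMonomial (θ : InnerFunction) (n : ℕ) : L2 :=
  fourierLp 2 (n : ℤ) - mulOp θ.toL2 θ.memLp_top (analyticPart θ n)

theorem memLp_top_fourierLp (n : ℤ) : MemLp (fourierLp 2 n : L2) ∞ AddCircle.haarAddCircle :=
  (memLp_congr_ae (coeFn_fourierLp_two n)).mpr (memLp_continuous _)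

theorem memLp_top_sum (s : Finset ℕ) (c : ℕ → ℂ) :
    MemLp (∑ m ∈ s, c m • (fourierLp 2 (m : ℤ) : L2) : L2) ∞ AddCircle.haarAddCircle := by
  classical
  induction s using Finset.induction_on with
  | empty =>
    rw [Finset.sum_empty]
    exact (memLp_congr_ae (Lp.coeFn_zero _ _ _)).mpr MemLp.zero
  | insert a s ha ih =>
    rw [Finset.sum_insert ha]
    refine (memLp_congr_ae (Lp.coeFn_add _ _)).mpr (MemLp.add ?_ ih)
    exact (memLp_congr_ae (Lp.coeFn_smul _ _)).mpr ((memLp_top_fourierLp _).const_smul _)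

theorem memLp_top_projMonomial (θ : InnerFunction) (n : ℕ) :
    MemLp (projMonomial θ n) ∞ AddCircle.haarAddCircle := by
  refine (memLp_congr_ae (Lp.coeFn_sub _ _)).mpr ((memLp_top_fourierLp _).sub ?_)
  refine (memLp_congr_ae (coeFn_mulOp _ _ _)).mpr ?_
  exact (memLp_top_sum _ _).mul (p := ∞) θ.memLp_top

theorem mulOp_inner_mem_H2 (θ : InnerFunction) (n : ℕ) :
    mulOp θ.toL2 θ.memLp_top (fourierLp 2 (n : ℤ)) ∈ H2 := by
  intro k hk
  have : ⇑(mulOp θ.toL2 θ.memLp_top (fourierLp 2 (n : ℤ))) =ᵐ[AddCircle.haarAddCircle]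
      fun x => fourier n x * θ.toL2 x := by
    filter_upwards [coeFn_mulOp _ θ.memLp_top (fourierLp 2 (n : ℤ)), coeFn_fourierLp_two n]
      with x h1 h2
    rw [h1, h2, mul_comm]
  rw [fourierCoeff_eq_of_ae this, fourierCoeff_fourier_mul]
  exact θ.mem_H2 _ (by omega)

/-- The `k`-th coefficient of `conj θ · zⁿ` is the conjugate of the coefficient of `θ` at `n - k`,
which is zero for `k > n`. The analytic part is therefore a polynomial, and subtracting it removes
all coefficients of nonnegative index. -/
theorem projMonomial_mem_K (θ : InnerFunction) (n : ℕ) : projMonomial θ n ∈ K θ := by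
  rw [mem_K_iff]
  constructor
  · refine H2.sub_mem (fourierLp_mem_H2 (by omega)) ?_
    rw [analyticPart, map_sum]
    refine Submodule.sum_mem _ fun m _ => ?_
    rw [map_smul]
    exact H2.smul_mem _ (mulOp_inner_mem_H2 θ m)
  · intro k hk
    have h : (fun x => conj (θ.toL2 x) * projMonomial θ n x) =ᵐ[AddCircle.haarAddCircle]
        fun x => fourier n x * conj (θ.toL2 x) - analyticPart θ n x := by
      filter_upwards [Lp.coeFn_sub (fourierLp 2 (n : ℤ) : L2)
          (mulOp θ.toL2 θ.memLp_top (analyticPart θ n)), coeFn_fourierLp_two n,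
        coeFn_mulOp _ θ.memLp_top (analyticPart θ n), θ.conj_mul_self] with x h1 h2 h3 h4
      rw [projMonomial, h1, Pi.sub_apply, h2, h3, mul_sub, ← mul_assoc, h4]
      ring
    have hi : Integrable (fun x => conj (θ.toL2 x)) AddCircle.haarAddCircle :=
      θ.memLp_conj.integrable le_top
    rw [fourierCoeff_eq_of_ae h, fourierCoeff_sub' (integrable_fourier_mul hi _)
      (integrable_coeFn _), fourierCoeff_fourier_mul, fourierCoeff_conj, analyticPart,
      fourierCoeff_sum_smul_fourierLp]
    lift k to ℕ using hk
    simp only [Nat.cast_inj, mul_ite, mul_one, mul_zero, Finset.sum_ite_eq, Finset.mem_range]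
    split_ifs with hkn
    · rw [neg_sub, sub_self]
    · rw [θ.mem_H2 _ (by omega)]; simp

theorem inner_projMonomial (θ : InnerFunction) (n : ℕ) {f : L2} (hf : f ∈ K θ) :
    ⟪projMonomial θ n, f⟫_ℂ = fourierCoeff f n := by
  rw [projMonomial, inner_sub_left, inner_fourierLp, sub_eq_self]
  refine (Submodule.mem_orthogonal _ _).mp hf.2 _ (Submodule.mem_map_of_mem ?_)
  exact Submodule.sum_mem _ fun m _ => H2.smul_mem _ (fourierLp_mem_H2 (by omega))

/-- The bounded elements of `K_θ`. -/
def boundedElements (θ : InnerFunction) : Submodule ℂ (K θ) where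
  carrier := {f | MemLp (f : L2) ∞ AddCircle.haarAddCircle}
  zero_mem' := (memLp_congr_ae (Lp.coeFn_zero _ _ _)).mpr MemLp.zero
  add_mem' hf hg := (memLp_congr_ae (Lp.coeFn_add _ _)).mpr (hf.add hg)
  smul_mem' c _ hf := (memLp_congr_ae (Lp.coeFn_smul _ _)).mpr (hf.const_smul c)

/-- The bounded vectors `projMonomial θ n` reproduce the Fourier coefficients on `K θ`, so only `0`
is orthogonal to all bounded elements. In finite dimension a subspace with trivial orthogonal
complement is the whole space. -/
theorem memLp_top_of_finiteDimensional (θ : InnerFunction) [FiniteDimensional ℂ (K θ)]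
    (f : K θ) : MemLp (f : L2) ∞ AddCircle.haarAddCircle := by
  have h : boundedElements θ = ⊤ := by
    rw [← Submodule.orthogonal_eq_bot_iff, Submodule.eq_bot_iff]
    intro g hg
    rw [Submodule.mem_orthogonal] at hg
    apply Subtype.ext
    refine eq_zero_of_fourierCoeff fun n => ?_
    rcases lt_or_ge n 0 with hn | hn
    · exact g.2.1 n hn
    · lift n to ℕ using hn
      rw [← inner_projMonomial θ n g.2]
      exact hg ⟨projMonomial θ n, projMonomial_mem_K θ n⟩ (memLp_top_projMonomial θ n)
  have hf : f ∈ boundedElements θ := by rw [h]; trivial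
  exact hf

/-! ### The compressed Möbius multiplication and the Clark functional -/

theorem szego_mul (t : 𝔻) (x : UnitAddCircle) :
    (1 - conj (t : ℂ) * fourier 1 x) * szego t x = 1 :=
  mul_one_div_cancel (one_sub_ne_zero t x)

theorem moebius_eq (t : 𝔻) (x : UnitAddCircle) :
    moebius t x = (fourier 1 x - (t : ℂ)) * szego t x :=
  (mul_one_div _ _).symm

theorem mulC_szego_mem_H2 (t : 𝔻) {f : L2} (hf : f ∈ H2) : mulC (szego t) f ∈ H2 := by
  refine fourierCoeff_eq_zero_of_one_sub_mul (integrable_coeFn _) t fun n hn => ?_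
  rw [← hf n hn]
  refine fourierCoeff_eq_of_ae ?_ n
  filter_upwards [coeFn_mulC (szego t) f] with x hx
  rw [hx, ← mul_assoc, szego_mul, one_mul]

/-- The functional `f ↦ ∫ conj θ · z f / (1 - conj t · z)`. -/
def clarkFunctional (θ : InnerFunction) (t : 𝔻) (f : L2) : ℂ :=
  fourierCoeff (fun x => szego t x * (conj (θ.toL2 x) * f x)) (-1)

theorem integrable_conj_mul (θ : InnerFunction) (f : L2) :
    Integrable (fun x => conj (θ.toL2 x) * f x) AddCircle.haarAddCircle :=
  (integrable_congr (coeFn_mulOp _ θ.memLp_conj f)).mp (integrable_coeFn _)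

theorem fourierCoeff_moebius_mul {f : UnitAddCircle → ℂ} (hf : Integrable f AddCircle.haarAddCircle)
    (t : 𝔻) (n : ℤ) : fourierCoeff (fun x => moebius t x * f x) n =
      fourierCoeff (fun x => szego t x * f x) (n - 1) -
        t * fourierCoeff (fun x => szego t x * f x) n := by
  have hs := integrable_continuous_mul hf (szego t)
  have h : (fun x => moebius t x * f x) =
      fun x => fourier 1 x * (szego t x * f x) - t * (szego t x * f x) := by
    ext x; rw [moebius_eq]; ring
  rw [h, fourierCoeff_sub' (integrable_fourier_mul hs 1) (hs.const_mul _),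
    fourierCoeff_const_mul, fourierCoeff_fourier_mul]

theorem fourierCoeff_szego_mul {f : UnitAddCircle → ℂ} (hf : Integrable f AddCircle.haarAddCircle)
    (t : 𝔻) (n : ℤ) : fourierCoeff (fun x => szego t x * f x) n =
      fourierCoeff f n + conj (t : ℂ) * fourierCoeff (fun x => szego t x * f x) (n - 1) := by
  have h := fourierCoeff_one_sub_mul (integrable_continuous_mul hf (szego t)) (conj (t : ℂ)) n
  simp only [← mul_assoc, szego_mul, one_mul] at h
  rw [h]; ring

/-- Multiplying back by `1 - conj t · z` leaves no coefficients of nonnegative index, so from index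
`-1` on the coefficients form a geometric sequence. -/
theorem fourierCoeff_szego_mul_of_nonneg {f : UnitAddCircle → ℂ}
    (hf : Integrable f AddCircle.haarAddCircle) (h : ∀ n : ℤ, 0 ≤ n → fourierCoeff f n = 0)
    (t : 𝔻) (n : ℕ) : fourierCoeff (fun x => szego t x * f x) ((n : ℤ) - 1) =
      conj (t : ℂ) ^ n * fourierCoeff (fun x => szego t x * f x) (-1) := by
  induction n with
  | zero => simp
  | succ n ih =>
    rw [fourierCoeff_szego_mul hf, h _ (by push_cast; omega), Nat.cast_succ,
      add_sub_cancel_right, ih, pow_succ]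
    ring

theorem fourierCoeff_szego (t : 𝔻) (n : ℕ) : fourierCoeff (szego t) n = conj (t : ℂ) ^ n := by
  have hone : ∀ n : ℤ, fourierCoeff (fun _ : UnitAddCircle => (1 : ℂ)) n =
      if n = 0 then 1 else 0 := by
    intro n
    rw [← fourierCoeff_fourierLp]
    refine fourierCoeff_eq_of_ae ?_ n
    filter_upwards [coeFn_fourierLp_two 0] with x hx
    rw [hx, fourier_zero]
  have hrec := fourierCoeff_szego_mul (f := fun _ => (1 : ℂ)) (integrable_const _) t
  simp only [mul_one, hone] at hrec
  have hneg : fourierCoeff (szego t) (-1) = 0 := by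
    refine fourierCoeff_eq_zero_of_one_sub_mul
      ((memLp_continuous (szego t)).integrable le_top) t (fun n hn => ?_) _ (by norm_num)
    simp only [szego_mul, hone]
    rw [if_neg hn.ne]
  induction n with
  | zero =>
    rw [hrec]
    simp [hneg]
  | succ n ih =>
    rw [hrec, if_neg (by omega), Nat.cast_succ, add_sub_cancel_right, ih, pow_succ]
    ring

/-- The products of `θ` with Cauchy kernels are orthogonal to `K_θ`. -/
theorem mulC_szego_inner_mem_orthogonal (θ : InnerFunction) (t : 𝔻) :
    mulC (szego t) θ.toL2 ∈ (K θ)ᗮ := by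
  have h : mulC (szego t) θ.toL2 = mulOp θ.toL2 θ.memLp_top (mulC (szego t) (fourierLp 2 0)) := by
    apply Lp.ext
    filter_upwards [coeFn_mulC (szego t) θ.toL2, coeFn_fourierLp_two 0,
      coeFn_mulC (szego t) (fourierLp 2 0),
      coeFn_mulOp θ.toL2 θ.memLp_top (mulC (szego t) (fourierLp 2 0))] with x h1 h2 h3 h4
    rw [h1, h4, h3, h2, fourier_zero, mul_one, mul_comm]
  rw [h, Submodule.mem_orthogonal']
  intro f hf
  exact (Submodule.mem_orthogonal _ _).mp hf.2 _
    (Submodule.mem_map_of_mem (mulC_szego_mem_H2 t (fourierLp_mem_H2 le_rfl)))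

/-- The nonnegative part of `conj θ` times the Möbius multiple of `f` is geometric with ratio `conj
t`, hence a multiple of the Szegő kernel. The factor `1 - conj t · t` comes from the numerator `z -
t`. The term removed is orthogonal to `K θ`, so this computes the projection. -/
theorem moebius_mul_sub_mem_K (θ : InnerFunction) (t : 𝔻) {f : L2} (hf : f ∈ K θ) :
    mulC (moebius t) f - ((1 - conj (t : ℂ) * t) * clarkFunctional θ t f) •
      mulC (szego t) θ.toL2 ∈ K θ := by
  set d : ℂ := (1 - conj (t : ℂ) * t) * clarkFunctional θ t f with hd
  obtain ⟨hf1, hf2⟩ := (mem_K_iff θ f).mp hf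
  rw [mem_K_iff]
  constructor
  · refine H2.sub_mem (fun n hn => ?_) (H2.smul_mem _ (mulC_szego_mem_H2 t θ.mem_H2))
    have hs : ∀ n < 0, fourierCoeff (fun x => szego t x * f x) n = 0 := fun n hn => by
      rw [← fourierCoeff_eq_of_ae (coeFn_mulC (szego t) f) n]
      exact mulC_szego_mem_H2 t hf1 n hn
    rw [fourierCoeff_eq_of_ae (coeFn_mulC (moebius t) f),
      fourierCoeff_moebius_mul (integrable_coeFn _), hs n hn, hs (n - 1) (by omega)]
    ring
  · intro n hn
    lift n to ℕ using hn
    have hu := integrable_conj_mul θ f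
    have h : (fun x => conj (θ.toL2 x) * (mulC (moebius t) f - d • mulC (szego t) θ.toL2 : L2) x)
        =ᵐ[AddCircle.haarAddCircle]
        fun x => moebius t x * (conj (θ.toL2 x) * f x) - d * szego t x := by
      filter_upwards [Lp.coeFn_sub (mulC (moebius t) f) (d • mulC (szego t) θ.toL2),
        Lp.coeFn_smul d (mulC (szego t) θ.toL2), coeFn_mulC (moebius t) f,
        coeFn_mulC (szego t) θ.toL2, θ.conj_mul_self] with x h1 h2 h3 h4 h5
      rw [h1, Pi.sub_apply, h2, Pi.smul_apply, h3, h4, smul_eq_mul]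
      linear_combination (-d * szego t x) * h5
    rw [fourierCoeff_eq_of_ae h, fourierCoeff_sub' (integrable_continuous_mul hu _)
      (((memLp_continuous (szego t)).integrable le_top).const_mul d), fourierCoeff_const_mul,
      fourierCoeff_szego, fourierCoeff_moebius_mul hu]
    have h1 := fourierCoeff_szego_mul_of_nonneg hu hf2 t n
    have h2 := fourierCoeff_szego_mul hu t n
    rw [hf2 n (by omega)] at h2
    rw [h2, h1, hd, clarkFunctional]
    ring

theorem orthogonalProjection_moebius (θ : InnerFunction) (t : 𝔻) (f : K θ) :
    ((K θ).orthogonalProjectionOnto (mulC (moebius t) (f : L2)) : L2) = mulC (moebius t) (f : L2) -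
      ((1 - conj (t : ℂ) * t) * clarkFunctional θ t f) • mulC (szego t) θ.toL2 := by
  set d : ℂ := (1 - conj (t : ℂ) * t) * clarkFunctional θ t f
  have h : mulC (moebius t) (f : L2) = (mulC (moebius t) (f : L2) - d • mulC (szego t) θ.toL2) +
      d • mulC (szego t) θ.toL2 := by abel
  refine Submodule.eq_starProjection_of_mem_orthogonal' (moebius_mul_sub_mem_K θ t f.2)
    ((K θ)ᗮ.smul_mem d (mulC_szego_inner_mem_orthogonal θ t)) h

theorem coeFn_conjC (θ : InnerFunction) (f : L2) :
    ⇑(conjC θ f) =ᵐ[AddCircle.haarAddCircle]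
      fun x => θ.toL2 x * conj (fourier 1 x * f x) := by
  filter_upwards [coeFn_mulOp θ.toL2 θ.memLp_top (star (mulC (fourier 1) f)),
    Lp.coeFn_star (mulC (fourier 1) f), coeFn_mulC (fourier 1) f] with x h1 h2 h3
  rw [conjC, h1, h2, Pi.star_apply, h3]
  rfl

theorem coeFn_kernel (θ : InnerFunction) (t : 𝔻) :
    ⇑(kernel θ t) =ᵐ[AddCircle.haarAddCircle]
      fun x => szego t x * (1 - conj (diskEval θ.toL2 t) * θ.toL2 x) := by
  filter_upwards [coeFn_mulC (szego t) (fourierLp 2 0 - conj (diskEval θ.toL2 t) • θ.toL2),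
    Lp.coeFn_sub (fourierLp 2 0 : L2) (conj (diskEval θ.toL2 t) • θ.toL2),
    Lp.coeFn_smul (conj (diskEval θ.toL2 t)) θ.toL2, coeFn_fourierLp_two 0] with x h1 h2 h3 h4
  rw [kernel, h1, h2, Pi.sub_apply, h3, h4, Pi.smul_apply, fourier_zero, smul_eq_mul]

theorem coeFn_normKernel (θ : InnerFunction) (t : 𝔻) :
    ⇑(normKernel θ t) =ᵐ[AddCircle.haarAddCircle] fun x => ((‖kernel θ t‖⁻¹ : ℝ) : ℂ) *
      (szego t x * (1 - conj (diskEval θ.toL2 t) * θ.toL2 x)) := by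
  filter_upwards [Lp.coeFn_smul ((‖kernel θ t‖⁻¹ : ℝ) : ℂ) (kernel θ t), coeFn_kernel θ t]
    with x h1 h2
  rw [normKernel, h1, Pi.smul_apply, h2, smul_eq_mul]

/-- The term of the kernel containing `θ t` contributes a coefficient of index `-1` of an `H²`
function, which is zero. Thus the rank-one term of the Clark operator depends on `f` through the
same functional as the projection does. -/
theorem inner_conjC_normKernel (θ : InnerFunction) (t : 𝔻) {f : L2} (hf : f ∈ K θ) :
    ⟪conjC θ (normKernel θ t), f⟫_ℂ = ((‖kernel θ t‖⁻¹ : ℝ) : ℂ) * clarkFunctional θ t f := by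
  set r : ℂ := ((‖kernel θ t‖⁻¹ : ℝ) : ℂ)
  have hs : fourierCoeff (fun x => szego t x * f x) (-1) = 0 := by
    rw [← fourierCoeff_eq_of_ae (coeFn_mulC (szego t) f)]
    exact mulC_szego_mem_H2 t hf.1 _ (by norm_num)
  have hi1 := integrable_continuous_mul (integrable_conj_mul θ f) (szego t)
  have hi2 := integrable_continuous_mul (integrable_coeFn f) (szego t)
  have h : r * clarkFunctional θ t f = fourierCoeff (fun x =>
      r * (szego t x * (conj (θ.toL2 x) * f x) -
        conj (diskEval θ.toL2 t) * (szego t x * f x))) (-1) := by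
    rw [fourierCoeff_const_mul, fourierCoeff_sub' hi1 (hi2.const_mul _), fourierCoeff_const_mul,
      hs, clarkFunctional]
    ring
  rw [h, L2.inner_def, fourierCoeff]
  apply integral_congr_ae
  filter_upwards [coeFn_conjC θ (normKernel θ t), coeFn_normKernel θ t, θ.conj_mul_self]
    with x h1 h2 h3
  rw [h1, h2, RCLike.inner_apply, smul_eq_mul, neg_neg, map_mul, Complex.conj_conj]
  linear_combination (-f x * fourier 1 x * r * szego t x * conj (diskEval θ.toL2 t)) * h3

/-! ### Eigenvectors of generalised Clark operators -/

/-- All eigenvectors of a generalised Clark operator are multiples of one function, divided by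
linear polynomials. -/
theorem exists_eigenvector_clarkOp_eq (θ : InnerFunction) (t : 𝔻) (α : Circle) :
    ∃ G : UnitAddCircle → ℂ, ∀ (f : K θ) (μ : ℂ), clarkOp θ t α f = μ • (f : L2) →
      ∀ᵐ x ∂(AddCircle.haarAddCircle : Measure UnitAddCircle),
        ((fourier 1 x - (t : ℂ)) - μ * (1 - conj (t : ℂ) * fourier 1 x)) * (f : L2) x =
          clarkFunctional θ t f * G x := by
  set r : ℂ := ((‖kernel θ t‖⁻¹ : ℝ) : ℂ) with hr
  set β : ℂ := (α : ℂ) + diskEval θ.toL2 t with hβ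
  -- Multiplying the eigenvalue equation by `1 - conj t · z` clears the denominators; `G` collects
  -- the two terms carrying the factor `clarkFunctional θ t f`.
  refine ⟨fun x => (1 - conj (t : ℂ) * t) * θ.toL2 x -
    β * r * r * (1 - conj (diskEval θ.toL2 t) * θ.toL2 x), fun f μ h => ?_⟩
  set A := clarkFunctional θ t f with hA
  have h' : mulC (moebius t) (f : L2) - ((1 - conj (t : ℂ) * t) * A) • mulC (szego t) θ.toL2 +
      (β * (r * A)) • normKernel θ t = μ • (f : L2) := by
    rw [← h, ← orthogonalProjection_moebius, ← inner_conjC_normKernel θ t f.2, mul_smul]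
    rfl
  have e1 := Lp.coeFn_add (mulC (moebius t) (f : L2) -
    ((1 - conj (t : ℂ) * t) * A) • mulC (szego t) θ.toL2) ((β * (r * A)) • normKernel θ t)
  rw [h'] at e1
  filter_upwards [e1, Lp.coeFn_sub (mulC (moebius t) (f : L2))
      (((1 - conj (t : ℂ) * t) * A) • mulC (szego t) θ.toL2),
    Lp.coeFn_smul ((1 - conj (t : ℂ) * t) * A) (mulC (szego t) θ.toL2),
    Lp.coeFn_smul (β * (r * A)) (normKernel θ t), Lp.coeFn_smul μ (f : L2),
    coeFn_mulC (moebius t) (f : L2), coeFn_mulC (szego t) θ.toL2, coeFn_normKernel θ t]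
    with x e1 e2 e3 e4 e5 e6 e7 e8
  rw [e5, Pi.add_apply, e2, Pi.sub_apply, e3, e4, Pi.smul_apply, Pi.smul_apply, Pi.smul_apply,
    e6, e7, e8, moebius_eq] at e1
  simp only [smul_eq_mul, ← hr] at e1
  have hs := szego_mul t x
  linear_combination (-(1 - conj (t : ℂ) * fourier 1 x)) * e1 +
    (-(fourier 1 x - (t : ℂ)) * (f : L2) x + (1 - conj (t : ℂ) * t) * A * θ.toL2 x -
      β * r * A * r * (1 - conj (diskEval θ.toL2 t) * θ.toL2 x)) * hs

theorem ae_fourier_one_ne (w : ℂ) :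
    ∀ᵐ x ∂(AddCircle.haarAddCircle : Measure UnitAddCircle), fourier 1 x ≠ w := by
  have hnt : Nontrivial UnitAddCircle :=
    ⟨((1 / 2 : ℝ) : UnitAddCircle), 0, fun h => by
      rw [AddCircle.coe_eq_zero_iff_of_mem_Ico (by norm_num)] at h
      norm_num at h⟩
  have hsub : {x : UnitAddCircle | fourier 1 x = w}.Subsingleton := by
    intro x hx y hy
    have h : fourier 1 x = fourier 1 y := Eq.trans hx (Eq.symm hy)
    rw [fourier_one, fourier_one] at h
    exact AddCircle.injective_toCircle one_ne_zero (Circle.coe_injective h)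
  have := hsub.measure_zero (AddCircle.haarAddCircle : Measure UnitAddCircle)
  rw [ae_iff]
  simpa using this

/-- A polynomial of degree one vanishes at no more than one point of the circle. If the coefficient
of `z` is zero, a root would force `μ = -t` and then `|t| = 1`. -/
theorem ae_linear_ne_zero (t : 𝔻) (μ : ℂ) :
    ∀ᵐ x ∂(AddCircle.haarAddCircle : Measure UnitAddCircle),
      (fourier 1 x - (t : ℂ)) - μ * (1 - conj (t : ℂ) * fourier 1 x) ≠ 0 := by
  by_cases h : 1 + μ * conj (t : ℂ) = 0
  · refine Filter.Eventually.of_forall fun x hx => ?_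
    have h1 : μ = -(t : ℂ) := by linear_combination (fourier 1 x) * h - hx
    rw [h1, neg_mul, Complex.mul_conj', ← sub_eq_add_neg, sub_eq_zero] at h
    have h2 : ‖(t : ℂ)‖ ^ 2 = 1 := by exact_mod_cast h.symm
    have h3 := t.norm_lt_one
    nlinarith [norm_nonneg (t : ℂ)]
  · filter_upwards [ae_fourier_one_ne ((t + μ) / (1 + μ * conj (t : ℂ)))] with x hx h0
    apply hx
    rw [eq_div_iff h]
    linear_combination h0

theorem conj_ae_eq_of_conjC_eq (θ : InnerFunction) {f : L2} (hf : conjC θ f = f) :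
    ∀ᵐ x ∂(AddCircle.haarAddCircle : Measure UnitAddCircle),
      conj (f x) = conj (θ.toL2 x) * (fourier 1 x * f x) := by
  have h := coeFn_conjC θ f
  rw [hf] at h
  filter_upwards [h] with x hx
  have h1 := congrArg conj hx
  rwa [map_mul, Complex.conj_conj] at h1

/-! ### Matrix entries in a modified Clark basis -/

/-- The symbol describes `A` only on bounded functions, which here are all of `K θ`. The projection
disappears because the result is paired with `v i ∈ K θ`. -/
theorem toMatrix_tto_apply {θ : InnerFunction} {n : ℕ} (v : OrthonormalBasis (Fin n) ℂ (K θ))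
    {A : K θ →L[ℂ] K θ} {φ : L2}
    (hφ : ∀ (f : K θ) (hf : MemLp (f : L2) ∞ AddCircle.haarAddCircle),
      A f = (K θ).orthogonalProjectionOnto (mulOp (f : L2) hf φ)) (i j : Fin n) :
    Integrable (fun x => conj ((v i : L2) x) * ((v j : L2) x * φ x)) AddCircle.haarAddCircle ∧
      LinearMap.toMatrix v.toBasis v.toBasis A.toLinearMap i j =
        ∫ x, conj ((v i : L2) x) * ((v j : L2) x * φ x) ∂AddCircle.haarAddCircle := by
  have : FiniteDimensional ℂ (K θ) := v.toBasis.finiteDimensional_of_finite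
  have hb := memLp_top_of_finiteDimensional θ (v j)
  have hae : (fun x => ⟪(v i : L2) x, mulOp (v j : L2) hb φ x⟫_ℂ) =ᵐ[AddCircle.haarAddCircle]
      fun x => conj ((v i : L2) x) * ((v j : L2) x * φ x) := by
    filter_upwards [coeFn_mulOp _ hb φ] with x hx
    rw [hx, RCLike.inner_apply, mul_comm]
  refine ⟨(integrable_congr hae).mp (L2.integrable_inner _ _), ?_⟩
  rw [← integral_congr_ae hae, ← L2.inner_def, LinearMap.toMatrix_apply,
    OrthonormalBasis.coe_toBasis, OrthonormalBasis.coe_toBasis_repr_apply,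
    OrthonormalBasis.repr_apply_apply]
  change ⟪v i, A (v j)⟫_ℂ = _
  rw [hφ (v j) hb, Submodule.inner_orthogonalProjectionOnto_eq_of_mem_left]

/-- The off-diagonal entries of the matrix of a truncated Toeplitz operator with respect to a
modified Clark basis with three elements satisfy a linear relation with nonzero coefficients. -/
theorem exists_offDiagonal_relation {θ : InnerFunction} (v : OrthonormalBasis (Fin 3) ℂ (K θ))
    (hv : IsModifiedClarkBasis θ v) {A : K θ →L[ℂ] K θ} (hA : IsTTO θ A) :
    ∃ c₀ c₁ c₂ : ℂ, c₀ ≠ 0 ∧ c₁ ≠ 0 ∧ c₂ ≠ 0 ∧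
      c₀ * LinearMap.toMatrix v.toBasis v.toBasis A.toLinearMap 1 2 +
      c₁ * LinearMap.toMatrix v.toBasis v.toBasis A.toLinearMap 0 2 +
      c₂ * LinearMap.toMatrix v.toBasis v.toBasis A.toLinearMap 0 1 = 0 := by
  obtain ⟨hC, t, α, hU⟩ := hv
  obtain ⟨φ, hφ⟩ := hA
  obtain ⟨G, hG⟩ := exists_eigenvector_clarkOp_eq θ t α
  choose μ hμ using hU
  set a : Fin 3 → ℂ := fun i => clarkFunctional θ t (v i) with ha
  have hℓ : ∀ i, ∀ᵐ x ∂(AddCircle.haarAddCircle : Measure UnitAddCircle),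
      ((fourier 1 x - (t : ℂ)) - μ i * (1 - conj (t : ℂ) * fourier 1 x)) * (v i : L2) x =
        a i * G x := fun i => hG (v i) (μ i) (hμ i)
  have ha0 : ∀ i, a i ≠ 0 := by
    intro i hi
    have h0 : (v i : L2) = 0 := by
      apply Lp.ext
      filter_upwards [hℓ i, ae_linear_ne_zero t (μ i), Lp.coeFn_zero ℂ 2 AddCircle.haarAddCircle]
        with x h1 h2 h3
      rw [hi, zero_mul] at h1
      rw [h3]
      exact (mul_eq_zero.mp h1).resolve_left h2
    have h1 := v.orthonormal.1 i
    rw [Submodule.coe_norm, h0, norm_zero] at h1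
    exact zero_ne_one h1
  -- Equal eigenvalues would give equal denominators, making two orthonormal vectors proportional.
  have hμinj : ∀ i j, i ≠ j → μ i - μ j ≠ 0 := by
    intro i j hij h
    have hμ' : μ i = μ j := sub_eq_zero.mp h
    have h0 : a j • v i = a i • v j := by
      apply Subtype.ext
      apply Lp.ext
      filter_upwards [hℓ i, hℓ j, ae_linear_ne_zero t (μ j), Lp.coeFn_smul (a j) (v i : L2),
        Lp.coeFn_smul (a i) (v j : L2)] with x h1 h2 h3 h4 h5
      rw [Submodule.coe_smul, Submodule.coe_smul, h4, h5, Pi.smul_apply, Pi.smul_apply,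
        smul_eq_mul, smul_eq_mul]
      apply mul_left_cancel₀ h3
      rw [hμ'] at h1
      linear_combination a j * h1 - a i * h2
    have h1 : ⟪v i, a j • v i⟫_ℂ = ⟪v i, a i • v j⟫_ℂ := by rw [h0]
    rw [inner_smul_right (v i) (v i) (a j), inner_smul_right (v i) (v j) (a i), orthonormal_iff_ite.mp v.orthonormal,
      orthonormal_iff_ite.mp v.orthonormal, if_neg hij, if_pos rfl, mul_one, mul_zero] at h1
    exact ha0 j h1
  -- The differences of the `μ i` are the coefficients of the dependence between the `p i`; the
  -- factor `a i` completes the product of the other two to `a 0 · a 1 · a 2`.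
  refine ⟨(μ 1 - μ 2) * a 0, (μ 2 - μ 0) * a 1, (μ 0 - μ 1) * a 2,
    mul_ne_zero (hμinj _ _ (by decide)) (ha0 0), mul_ne_zero (hμinj _ _ (by decide)) (ha0 1),
    mul_ne_zero (hμinj _ _ (by decide)) (ha0 2), ?_⟩
  obtain ⟨i12, e12⟩ := toMatrix_tto_apply v hφ 1 2
  obtain ⟨i02, e02⟩ := toMatrix_tto_apply v hφ 0 2
  obtain ⟨i01, e01⟩ := toMatrix_tto_apply v hφ 0 1
  have i12' := i12.const_mul ((μ 1 - μ 2) * a 0)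
  have i02' := i02.const_mul ((μ 2 - μ 0) * a 1)
  have i01' := i01.const_mul ((μ 0 - μ 1) * a 2)
  rw [e12, e02, e01, ← integral_const_mul, ← integral_const_mul, ← integral_const_mul,
    ← integral_add i12' i02', ← integral_add (by exact i12'.add i02') i01']
  refine integral_eq_zero_of_ae ?_
  filter_upwards [hℓ 0, hℓ 1, hℓ 2, ae_linear_ne_zero t (μ 0), ae_linear_ne_zero t (μ 1),
    ae_linear_ne_zero t (μ 2), conj_ae_eq_of_conjC_eq θ (hC 0), conj_ae_eq_of_conjC_eq θ (hC 1)]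
    with x l0 l1 l2 n0 n1 n2 c0 c1
  -- Only the row indices `0` and `1` are conjugated. Afterwards all three integrands share the
  -- factor `conj θ · z · φ`.
  rw [c0, c1]
  generalize (v 0 : L2) x = v0 at *
  generalize (v 1 : L2) x = v1 at *
  generalize (v 2 : L2) x = v2 at *
  generalize fourier 1 x = z at *
  have key : (μ 1 - μ 2) * a 0 * (v1 * v2) + (μ 2 - μ 0) * a 1 * (v0 * v2) +
      (μ 0 - μ 1) * a 2 * (v0 * v1) = 0 := by
    set p0 := z - (t : ℂ) - μ 0 * (1 - conj (t : ℂ) * z) with hp0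
    set p1 := z - (t : ℂ) - μ 1 * (1 - conj (t : ℂ) * z) with hp1
    set p2 := z - (t : ℂ) - μ 2 * (1 - conj (t : ℂ) * z) with hp2
    have e0 : v0 = a 0 * G x / p0 := by rw [eq_div_iff n0]; linear_combination l0
    have e1 : v1 = a 1 * G x / p1 := by rw [eq_div_iff n1]; linear_combination l1
    have e2 : v2 = a 2 * G x / p2 := by rw [eq_div_iff n2]; linear_combination l2
    have hp : (μ 1 - μ 2) * p0 + (μ 2 - μ 0) * p1 + (μ 0 - μ 1) * p2 = 0 := by
      rw [hp0, hp1, hp2]; ring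
    rw [e0, e1, e2]
    field_simp
    linear_combination (a 0 * a 1 * a 2 * G x ^ 2) * hp
  simp only [Pi.zero_apply]
  linear_combination (conj (θ.toL2 x) * z * φ x) * key

/-! ### Circulant operators on the model space of `zⁿ` -/

/-- The inner function `zⁿ`. -/
def powInner (n : ℕ) : InnerFunction where
  toL2 := fourierLp 2 n
  mem_H2 := fourierLp_mem_H2 (by omega)
  norm_eq_one := by
    filter_upwards [coeFn_fourierLp_two n] with x hx
    rw [hx, norm_fourier_apply]

theorem mem_K_powInner_iff (n : ℕ) (f : L2) :
    f ∈ K (powInner n) ↔ ∀ k : ℤ, k < 0 ∨ (n : ℤ) ≤ k → fourierCoeff f k = 0 := by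
  have h : ∀ k, fourierCoeff (fun x => conj ((powInner n).toL2 x) * f x) k =
      fourierCoeff f (k + n) := by
    intro k
    rw [← sub_neg_eq_add, ← fourierCoeff_fourier_mul]
    refine fourierCoeff_eq_of_ae ?_ k
    filter_upwards [coeFn_fourierLp_two n] with x hx
    rw [powInner, hx, fourier_neg]
  rw [mem_K_iff]
  simp only [h]
  constructor
  · rintro ⟨h1, h2⟩ k (hk | hk)
    · exact h1 k hk
    · simpa using h2 (k - n) (by omega)
  · exact fun h => ⟨fun k hk => h k (Or.inl hk), fun k hk => h _ (Or.inr (by omega))⟩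

/-- The monomials `zᵐ`, `m < n`, as elements of the model space of `zⁿ`. -/
def monomial {n : ℕ} (m : Fin n) : K (powInner n) :=
  ⟨fourierLp 2 (m : ℤ), by
    rw [mem_K_powInner_iff]
    intro k hk
    rw [fourierCoeff_fourierLp, if_neg]
    omega⟩

theorem inner_monomial {n : ℕ} (m : Fin n) (f : K (powInner n)) :
    ⟪monomial m, f⟫_ℂ = fourierCoeff (f : L2) m :=
  inner_fourierLp m (f : L2)

theorem orthonormal_monomial (n : ℕ) : Orthonormal ℂ (monomial (n := n)) := by
  rw [orthonormal_iff_ite]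
  intro i j
  rw [inner_monomial, monomial, fourierCoeff_fourierLp]
  simp [Fin.ext_iff]

theorem eq_of_inner_monomial {n : ℕ} {f g : K (powInner n)}
    (h : ∀ m : Fin n, ⟪monomial m, f⟫_ℂ = ⟪monomial m, g⟫_ℂ) : f = g := by
  rw [← sub_eq_zero]
  apply Subtype.ext
  refine eq_zero_of_fourierCoeff fun k => ?_
  by_cases hk : k < 0 ∨ (n : ℤ) ≤ k
  · exact (mem_K_powInner_iff n _).mp (f - g).2 k hk
  · push Not at hk
    obtain ⟨hk0, hkn⟩ := hk
    lift k to ℕ using hk0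
    have h1 := inner_monomial ⟨k, by omega⟩ (f - g)
    rw [inner_sub_right, h, sub_self] at h1
    exact h1.symm

/-- The monomials form an orthonormal basis of the model space of `zⁿ`. -/
def monomialBasis (n : ℕ) : OrthonormalBasis (Fin n) ℂ (K (powInner n)) :=
  OrthonormalBasis.mk (orthonormal_monomial n) <| by
    intro f _
    have h : f = ∑ m, ⟪monomial m, f⟫_ℂ • monomial m := by
      refine eq_of_inner_monomial fun k => ?_
      rw [(orthonormal_monomial n).inner_right_fintype]
    rw [h]
    exact Submodule.sum_mem _ fun m _ =>
      Submodule.smul_mem _ _ (Submodule.subset_span (Set.mem_range_self m))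

instance (n : ℕ) : FiniteDimensional ℂ (K (powInner n)) :=
  (monomialBasis n).toBasis.finiteDimensional_of_finite

/-- The `n`-th roots of unity. -/
def unityRoot (n : ℕ) (j : Fin n) : ℂ := exp (2 * Real.pi * I / n) ^ (j : ℕ)

theorem unityRoot_ne_zero {n : ℕ} (j : Fin n) : unityRoot n j ≠ 0 :=
  pow_ne_zero _ (exp_ne_zero _)

theorem conj_unityRoot {n : ℕ} [NeZero n] (j : Fin n) :
    conj (unityRoot n j) = (unityRoot n j)⁻¹ := by
  rw [Complex.inv_eq_conj]
  rw [unityRoot, norm_pow, (isPrimitiveRoot_exp n (NeZero.ne n)).norm'_eq_one (NeZero.ne n),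
    one_pow]

theorem sum_unityRoot {n : ℕ} [NeZero n] (l j : Fin n) :
    ∑ m : Fin n, ((unityRoot n l)⁻¹ * unityRoot n j) ^ (m : ℕ) = if l = j then (n : ℂ) else 0 := by
  have hζ := isPrimitiveRoot_exp n (NeZero.ne n)
  split_ifs with h
  · rw [h, inv_mul_cancel₀ (unityRoot_ne_zero j)]
    simp
  · rw [Fin.sum_univ_eq_sum_range (fun m => ((unityRoot n l)⁻¹ * unityRoot n j) ^ m)]
    have hne : (unityRoot n l)⁻¹ * unityRoot n j ≠ 1 := by
      intro h1
      rw [inv_mul_eq_one₀ (unityRoot_ne_zero l)] at h1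
      exact h (Fin.ext (hζ.pow_inj l.2 j.2 h1))
    have hpow : ∀ i : Fin n, unityRoot n i ^ n = 1 := fun i => by
      rw [unityRoot, ← pow_mul, mul_comm (i : ℕ), pow_mul, hζ.pow_eq_one, one_pow]
    rw [geom_sum_eq hne, mul_pow, inv_pow, hpow, hpow]
    simp

/-- The vectors of the Fourier basis of the model space of `zⁿ`. -/
def fourierVector {n : ℕ} (j : Fin n) : K (powInner n) :=
  ∑ m : Fin n, ((Real.sqrt n : ℂ)⁻¹ * unityRoot n j ^ (m : ℕ)) • monomial m

theorem inner_monomial_fourierVector {n : ℕ} (k j : Fin n) :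
    ⟪monomial k, fourierVector j⟫_ℂ = (Real.sqrt n : ℂ)⁻¹ * unityRoot n j ^ (k : ℕ) := by
  rw [fourierVector, (orthonormal_monomial n).inner_right_fintype]

theorem orthonormal_fourierVector (n : ℕ) [NeZero n] : Orthonormal ℂ (fourierVector (n := n)) := by
  have hn : (n : ℂ) ≠ 0 := NeZero.ne _
  have hs : (Real.sqrt n : ℂ) * Real.sqrt n = n := by
    rw [← ofReal_mul, Real.mul_self_sqrt (Nat.cast_nonneg n), ofReal_natCast]
  rw [orthonormal_iff_ite]
  intro l j
  rw [fourierVector, sum_inner]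
  have h : ∀ m : Fin n, ⟪((Real.sqrt n : ℂ)⁻¹ * unityRoot n l ^ (m : ℕ)) • monomial m,
      fourierVector j⟫_ℂ = (n : ℂ)⁻¹ * ((unityRoot n l)⁻¹ * unityRoot n j) ^ (m : ℕ) := by
    intro m
    rw [inner_smul_left (monomial m) (fourierVector j), inner_monomial_fourierVector, map_mul,
      map_pow, conj_unityRoot, map_inv₀, conj_ofReal, mul_pow, ← hs, mul_inv]
    ring
  simp only [h]
  rw [← Finset.mul_sum, sum_unityRoot]
  split_ifs <;> simp [hn]

/-- The Fourier basis of the model space of `zⁿ`. -/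
def fourierVectorBasis (n : ℕ) [NeZero n] : OrthonormalBasis (Fin n) ℂ (K (powInner n)) :=
  OrthonormalBasis.mk (orthonormal_fourierVector n)
    ((orthonormal_fourierVector n).linearIndependent.span_eq_top_of_card_eq_finrank' (by
      rw [Module.finrank_eq_card_basis (monomialBasis n).toBasis])).ge

/-- The coefficients of the symbol of the circulant operator with eigenvalues `lam`. -/
def circulantCoeff {n : ℕ} (lam : Fin n → ℂ) (r : ℤ) : ℂ :=
  (n : ℂ)⁻¹ * ∑ l, lam l * unityRoot n l ^ r

/-- The symbol of the circulant operator with eigenvalues `lam`. -/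
def circulantSymbol {n : ℕ} (lam : Fin n → ℂ) : C(UnitAddCircle, ℂ) :=
  ∑ r ∈ Finset.Ioo (-n : ℤ) n, circulantCoeff lam r • fourier r

theorem fourierCoeff_circulantSymbol {n : ℕ} (lam : Fin n → ℂ) {r : ℤ}
    (hr : r ∈ Finset.Ioo (-n : ℤ) n) :
    fourierCoeff (circulantSymbol lam) r = circulantCoeff lam r := by
  have h : fourierCoeff (ContinuousMap.toLp 2 AddCircle.haarAddCircle ℂ (circulantSymbol lam) : L2)
      r = circulantCoeff lam r := by
    rw [circulantSymbol, map_sum, ← inner_fourierLp, inner_sum, Finset.sum_eq_single_of_mem r hr]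
    · rw [map_smul, inner_smul_right, inner_fourierLp]
      change _ * fourierCoeff (fourierLp 2 r : L2) r = _
      rw [fourierCoeff_fourierLp, if_pos rfl, mul_one]
    · intro m _ hm
      rw [map_smul, inner_smul_right, inner_fourierLp]
      change _ * fourierCoeff (fourierLp 2 m : L2) r = _
      rw [fourierCoeff_fourierLp, if_neg hm.symm, mul_zero]
  rw [← h]
  exact (fourierCoeff_eq_of_ae (ContinuousMap.coeFn_toLp _ _) r).symm

theorem inner_fourierLp_mulC (g : C(UnitAddCircle, ℂ)) (k m : ℤ) :
    ⟪(fourierLp 2 k : L2), mulC g (fourierLp 2 m)⟫_ℂ = fourierCoeff g (k - m) := by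
  rw [inner_fourierLp, ← fourierCoeff_fourier_mul]
  refine fourierCoeff_eq_of_ae ?_ k
  filter_upwards [coeFn_mulC g (fourierLp 2 m), coeFn_fourierLp_two m] with x h1 h2
  rw [h1, h2, mul_comm]

/-- The compression of a multiplication operator to a finite-dimensional model space. -/
def compression (θ : InnerFunction) [FiniteDimensional ℂ (K θ)] (g : C(UnitAddCircle, ℂ)) :
    K θ →L[ℂ] K θ :=
  LinearMap.toContinuousLinearMap
    ((K θ).orthogonalProjectionOnto.toLinearMap ∘ₗ mulC g ∘ₗ (K θ).subtype)

theorem isTTO_compression (θ : InnerFunction) [FiniteDimensional ℂ (K θ)]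
    (g : C(UnitAddCircle, ℂ)) : IsTTO θ (compression θ g) := by
  refine ⟨ContinuousMap.toLp 2 AddCircle.haarAddCircle ℂ g, fun f hf => ?_⟩
  change (K θ).orthogonalProjectionOnto (mulC g (f : L2)) = _
  congr 1
  apply Lp.ext
  filter_upwards [coeFn_mulC g (f : L2), ContinuousMap.coeFn_toLp (p := 2) (𝕜 := ℂ)
    AddCircle.haarAddCircle g, coeFn_mulOp (f : L2) hf
      (ContinuousMap.toLp 2 AddCircle.haarAddCircle ℂ g)] with x h1 h2 h3
  rw [h1, h3, h2, mul_comm]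

/-- The entry at `(k, m)` is `n⁻¹ ∑ lam l · ω_l ^ (k - m)`, with `ω_l = unityRoot n l`. Summing
against `ω_j ^ m`, orthogonality of the roots of unity leaves only `l = j`. -/
theorem compression_circulantSymbol_apply {n : ℕ} [NeZero n] (lam : Fin n → ℂ) (j : Fin n) :
    compression (powInner n) (circulantSymbol lam) (fourierVector j) =
      lam j • fourierVector j := by
  have hn : (n : ℂ) ≠ 0 := NeZero.ne _
  refine eq_of_inner_monomial fun k => ?_
  rw [inner_smul_right (monomial k) (fourierVector j), inner_monomial_fourierVector]
  change ⟪monomial k, (K (powInner n)).orthogonalProjectionOnto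
    (mulC (circulantSymbol lam) (fourierVector j : L2))⟫_ℂ = _
  rw [Submodule.inner_orthogonalProjectionOnto_eq_of_mem_left, fourierVector]
  have h : ((∑ m : Fin n, ((Real.sqrt n : ℂ)⁻¹ * unityRoot n j ^ (m : ℕ)) • monomial m :
      K (powInner n)) : L2) = ∑ m : Fin n, ((Real.sqrt n : ℂ)⁻¹ * unityRoot n j ^ (m : ℕ)) •
        (fourierLp 2 (m : ℤ) : L2) := by
    rw [Submodule.coe_sum]
    rfl
  rw [h, map_sum, inner_sum]
  have h1 : ∀ m : Fin n, ⟪(monomial k : L2), mulC (circulantSymbol lam)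
      (((Real.sqrt n : ℂ)⁻¹ * unityRoot n j ^ (m : ℕ)) • (fourierLp 2 (m : ℤ) : L2))⟫_ℂ =
      ∑ l, ((Real.sqrt n : ℂ)⁻¹ * (n : ℂ)⁻¹ * lam l * unityRoot n l ^ (k : ℕ)) *
        ((unityRoot n l)⁻¹ * unityRoot n j) ^ (m : ℕ) := by
    intro m
    rw [map_smul, inner_smul_right, monomial, inner_fourierLp_mulC, fourierCoeff_circulantSymbol,
      circulantCoeff, Finset.mul_sum, Finset.mul_sum]
    · refine Finset.sum_congr rfl fun l _ => ?_
      rw [zpow_sub₀ (unityRoot_ne_zero l), zpow_natCast, zpow_natCast, mul_pow, inv_pow]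
      ring
    · rw [Finset.mem_Ioo]
      omega
  simp only [h1]
  rw [Finset.sum_comm]
  simp only [← Finset.mul_sum, sum_unityRoot]
  simp only [mul_ite, mul_zero, Finset.sum_ite_eq', Finset.mem_univ, if_true]
  field_simp

/-- Every Hermitian matrix is unitarily equivalent to a truncated Toeplitz operator, namely to a
circulant Toeplitz matrix. -/
theorem unitarilyEquivToTTO_of_isHermitian {n : ℕ} [NeZero n] {S : Matrix (Fin n) (Fin n) ℂ}
    (hS : S.IsHermitian) : UnitarilyEquivToTTO S := by
  refine ⟨powInner n, compression (powInner n) (circulantSymbol fun j => (hS.eigenvalues j : ℂ)),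
    -- The unitary matches the `j`-th eigenvector of `S` with the `j`-th Fourier vector, which has
    -- the same eigenvalue by the choice of symbol.
    isTTO_compression _ _, hS.eigenvectorBasis.equiv (fourierVectorBasis n) (Equiv.refl _), ?_⟩
  set U := hS.eigenvectorBasis.equiv (fourierVectorBasis n) (Equiv.refl _)
  have hU : ∀ j, U (hS.eigenvectorBasis j) = fourierVector j := fun j => by
    rw [OrthonormalBasis.equiv_apply_basis, fourierVectorBasis, OrthonormalBasis.coe_mk]
    rfl
  have h : U.toLinearEquiv.toLinearMap ∘ₗ S.toEuclideanLin =
      (compression (powInner n)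
        (circulantSymbol fun j => (hS.eigenvalues j : ℂ))).toLinearMap ∘ₗ
        U.toLinearEquiv.toLinearMap := by
    refine hS.eigenvectorBasis.toBasis.ext fun j => ?_
    rw [OrthonormalBasis.coe_toBasis]
    have hj : S.toEuclideanLin (hS.eigenvectorBasis j) =
        (hS.eigenvalues j : ℂ) • hS.eigenvectorBasis j := by
      apply (WithLp.ofLp_injective 2)
      exact hS.mulVec_eigenvectorBasis j
    change U (S.toEuclideanLin (hS.eigenvectorBasis j)) =
      compression (powInner n) _ (U (hS.eigenvectorBasis j))
    rw [hj, map_smul, hU, compression_circulantSymbol_apply]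
  exact fun x => LinearMap.congr_fun h x

end ModelSpace

end

/-! ### The counterexamples -/

theorem mainTheorem3 :
    (∀ (a b c : ℝ) (S : Matrix (Fin 3) (Fin 3) ℂ),
      (S = !![(a : ℂ), 0, 1; 0, (b : ℂ), 0; 1, 0, (c : ℂ)] ∨
       S = !![(a : ℂ), 1, 0; 1, (b : ℂ), 0; 0, 0, (c : ℂ)] ∨
       S = !![(a : ℂ), 0, 0; 0, (b : ℂ), 1; 0, 1, (c : ℂ)]) →
        ModelSpace.UnitarilyEquivToTTO S ∧ ¬ ModelSpace.IsClarkMatrixOfTTO S) ∧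
    ¬ (∀ (n : ℕ) (M : Matrix (Fin n) (Fin n) ℂ), M.IsSymm →
        ModelSpace.UnitarilyEquivToTTO M → ModelSpace.IsClarkMatrixOfTTO M) := by
  have main : ∀ (a b c : ℝ) (S : Matrix (Fin 3) (Fin 3) ℂ),
      (S = !![(a : ℂ), 0, 1; 0, (b : ℂ), 0; 1, 0, (c : ℂ)] ∨
       S = !![(a : ℂ), 1, 0; 1, (b : ℂ), 0; 0, 0, (c : ℂ)] ∨
       S = !![(a : ℂ), 0, 0; 0, (b : ℂ), 1; 0, 1, (c : ℂ)]) →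
        ModelSpace.UnitarilyEquivToTTO S ∧ ¬ ModelSpace.IsClarkMatrixOfTTO S := by
    intro a b c S hS
    constructor
    · apply ModelSpace.unitarilyEquivToTTO_of_isHermitian
      rcases hS with rfl | rfl | rfl <;>
      · ext i j
        fin_cases i <;> fin_cases j <;> simp [Matrix.conjTranspose_apply]
    · rintro ⟨θ, A, v, hA, hv, hM⟩
      obtain ⟨c₀, c₁, c₂, h₀, h₁, h₂, h⟩ := ModelSpace.exists_offDiagonal_relation v hv hA
      rw [hM] at h
      -- In each case two of the three entries vanish and the third is `1`, so the relation says
      -- that one of its coefficients is zero.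
      rcases hS with rfl | rfl | rfl
      · exact h₁ (by simpa using h)
      · exact h₂ (by simpa using h)
      · exact h₀ (by simpa using h)
  refine ⟨main, fun h => ?_⟩
  obtain ⟨h1, h2⟩ := main 0 0 0 _ (Or.inl rfl)
  refine h2 (h 3 _ ?_ h1)
  ext i j
  fin_cases i <;> fin_cases j <;> rfl
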